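/- Let $\mathcal X=\{(x,y)\in\mathbb R^2 : x<y\}$, $\overline{\mathcal X}=\{(x,y)\in\mathbb R^2 : x\le y\}$ and $\Delta=\{(x,x) : x\in\mathbb R\}$, with the metric $d_\infty((a,b),(c,d))=\max\{|a-c|,|b-d|\}$. A persistence measure is a Borel measure on $\mathcal X$. For persistence measures $\mu,\nu$, let $\Gamma(\mu,\nu)$ be the set of Borel measures $\pi$ on $\overline{\mathcal X}\times\overline{\mathcal X}$ such that $\pi(A\times\overline{\mathcal X})=\mu(A)$ and $\pi(\overline{\mathcal X}\times B)=\nu(B)$ for all Borel sets $A,B\subset\mathcal X$ (so the diagonal $\Delta$ serves as a source and sink of infinite mass). Define $$d_p(\mu,\nu)=\Big[\inf_{\pi\in\Gamma(\mu,\nu)}\int d_\infty(z,z')^p\,d\pi(z,z')\Big]^{1/p}\quad(1\le p<\infty),\qquad d_\infty(\mu,\nu)=\inf_{\pi\in\Gamma(\mu,\nu)}\ \sup_{(z,z')\in\operatorname{supp}\pi} d_\infty(z,z'),$$ let $\mathrm{Pers}_p(\mu)=d_p(\mu,0)$ be the distance to the empty diagram (the zero measure), and let $\mathcal D_p$ be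 the set of persistence measures $\mu$ with $\mathrm{Pers}_p(\mu)<\infty$. **Proposition.** Let $1\le p<q\le\infty$. 1. Let $\theta\in(0,1)$ and define $p_\theta$ by $\frac1{p_\theta}=\frac\theta p+\frac{1-\theta}q$ (with $1/\infty=0$). Then for all $\mu,\nu\in\mathcal D_p\cap\mathcal D_q$, $$d_{p_\theta}(\mu,\nu)\le 2^{1-\theta}\,d_p(\mu,\nu)^\theta\,\big(\mathrm{Pers}_q(\mu)+\mathrm{Pers}_q(\nu)\big)^{1-\theta}.$$ 2. Consequently, if $p\le r\le q$, then $\mathcal D_p\cap\mathcal D_q\subset\mathcal D_r$. -/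

import Mathlib

open MeasureTheory
open scoped ENNReal

namespace PersistenceOT

/-- The open half-plane above the diagonal. The metric on `ℝ × ℝ` is the `ℓ^∞` metric. -/
def openHalfPlane : Set (ℝ × ℝ) := {z | z.1 < z.2}

/-- The closed half-plane: the open half-plane together with the diagonal. -/
def closedHalfPlane : Set (ℝ × ℝ) := {z | z.1 ≤ z.2}

/-- The inclusion of the open half-plane into the closed one. -/
def incl (z : openHalfPlane) : closedHalfPlane :=
  ⟨z.1, le_of_lt (show z.1.1 < z.1.2 from z.2)⟩

/-- Transport plans between `μ` and `ν` when the diagonal is a source (and sink) of infinite mass: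
measures on pairs of points of the closed half-plane whose marginals agree with `μ` and `ν` off the
diagonal, and are unconstrained on the diagonal. -/
def plans (μ ν : Measure openHalfPlane) : Set (Measure (closedHalfPlane × closedHalfPlane)) :=
  {π | (∀ A : Set openHalfPlane, MeasurableSet A → π ((incl '' A) ×ˢ Set.univ) = μ A) ∧
       (∀ B : Set openHalfPlane, MeasurableSet B → π (Set.univ ×ˢ (incl '' B)) = ν B)}

open Classical in
/-- The Wasserstein `p`-distance between persistence measures, for `p ∈ [1, ∞]`. -/
noncomputable def wassersteinDist (p : ℝ≥0∞) (μ ν : Measure openHalfPlane) : ℝ≥0∞ :=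
  if p = ∞ then ⨅ π ∈ plans μ ν, ⨆ z ∈ π.support, edist z.1 z.2
  else (⨅ π ∈ plans μ ν, ∫⁻ z, edist z.1 z.2 ^ p.toReal ∂π) ^ (1 / p.toReal)

/-- `Pers_p`: the distance to the empty diagram, which consists of the diagonal only. -/
noncomputable def pers (p : ℝ≥0∞) (μ : Measure openHalfPlane) : ℝ≥0∞ := wassersteinDist p μ 0

/-- The space of persistence measures with finite `Pers_p`. -/
def finitePers (p : ℝ≥0∞) : Set (Measure openHalfPlane) := {μ | pers p μ < ∞}

end PersistenceOT

/-!
The distance between persistence measures is interpolated on a single transport plan. Any plan `π`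
between `μ` and `ν` can be replaced by a plan `rerouted π` in which every pair `(z, z')` with
`d(z, z') > d(z, Δ) + d(z', Δ)` is cut into the two pairs `(z, diagProj z)` and `(diagProj z', z')`,
where `diagProj` is the projection to the diagonal `Δ`. For `p ≥ 1` this does not increase the `L^p` norm of
the cost, since `d(z, Δ) ^ p + d(z', Δ) ^ p ≤ (d(z, Δ) + d(z', Δ)) ^ p` (`eLpNorm_rerouted_le`).
On the new plan the cost is at most `d(z, Δ) + d(z', Δ)`, so by Minkowski's inequality its `L^q` norm
is at most `Pers_q μ + Pers_q ν` for every `q ≥ 1`, including `q = ∞`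
(`eLpNorm_edist_rerouted_le_pers`). Interpolating the `L^p` and `L^q` norms by Hölder's inequality
(`eLpNorm_le_rpow_mul_rpow`) and taking the infimum over `π` gives the first claim, even without
the factor `2 ^ (1 - θ)`. The second claim is the case `ν = 0`.
-/

open Set

/-! ### Interpolation of `L^p` seminorms -/

/-- Lyapunov's inequality: the `L^s` seminorm is logarithmically convex in `1 / s`. -/
theorem eLpNorm_le_rpow_mul_rpow {α : Type*} [MeasurableSpace α] {m : Measure α} {f : α → ℝ≥0∞}
    (hf : AEMeasurable f m) {p q s : ℝ≥0∞} {θ : ℝ} (hθ0 : 0 < θ) (hθ1 : θ < 1)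
    (hp0 : p ≠ 0) (hpt : p ≠ ∞) (hq0 : q ≠ 0) (hs0 : s ≠ 0) (hst : s ≠ ∞)
    (hs : 1 / s = ENNReal.ofReal θ / p + ENNReal.ofReal (1 - θ) / q) :
    eLpNorm f s m ≤ eLpNorm f p m ^ θ * eLpNorm f q m ^ (1 - θ) := by
  have hp : 0 < p.toReal := ENNReal.toReal_pos hp0 hpt
  have hsp : 0 < s.toReal := ENNReal.toReal_pos hs0 hst
  have hreal : 1 / s.toReal = θ / p.toReal + (1 - θ) / q.toReal := by
    have h := congrArg ENNReal.toReal hs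
    rw [ENNReal.toReal_add (ENNReal.div_ne_top ENNReal.ofReal_ne_top hp0)
      (ENNReal.div_ne_top ENNReal.ofReal_ne_top hq0)] at h
    simpa [ENNReal.toReal_div, hθ0.le, hθ1.le] using h
  by_cases hqt : q = ∞
  · subst hqt
    simp only [ENNReal.toReal_top, div_zero, add_zero] at hreal
    have hpe : p.toReal = θ * s.toReal := by
      field_simp at hreal; linarith
    have hsub : s.toReal - p.toReal = (1 - θ) * s.toReal := by rw [hpe]; ring
    have hnn : 0 ≤ (1 - θ) * s.toReal := mul_nonneg (by linarith) hsp.le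
    have key : ∫⁻ x, f x ^ s.toReal ∂m
        ≤ (∫⁻ x, f x ^ p.toReal ∂m) * eLpNorm f ∞ m ^ ((1 - θ) * s.toReal) := by
      rw [← lintegral_mul_const'' _ (hf.pow_const _)]
      refine lintegral_mono_ae ?_
      filter_upwards [enorm_ae_le_eLpNormEssSup f m] with x hx
      rw [eLpNorm_exponent_top]
      calc f x ^ s.toReal = f x ^ p.toReal * f x ^ ((1 - θ) * s.toReal) := by
            rw [← ENNReal.rpow_add_of_nonneg _ _ hp.le hnn, ← hsub]; congr 1; ring
        _ ≤ _ := by gcongr; simpa using hx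
    rw [eLpNorm_eq_lintegral_rpow_enorm_toReal hs0 hst,
      eLpNorm_eq_lintegral_rpow_enorm_toReal hp0 hpt]
    simp only [enorm_eq_self]
    refine (ENNReal.rpow_le_rpow key (by positivity)).trans_eq ?_
    rw [ENNReal.mul_rpow_of_nonneg _ _ (by positivity), ← ENNReal.rpow_mul, ← ENNReal.rpow_mul,
      hreal]
    congr 2
    · ring
    · rw [← hreal]; field_simp
  · have hq : 0 < q.toReal := ENNReal.toReal_pos hq0 hqt
    set a := θ * s.toReal / p.toReal with ha
    set b := (1 - θ) * s.toReal / q.toReal with hb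
    have h1θ : 0 < 1 - θ := by linarith
    have ha0 : 0 ≤ a := by positivity
    have hb0 : 0 ≤ b := by positivity
    have hab : a + b = 1 := by
      have : a + b = s.toReal * (θ / p.toReal + (1 - θ) / q.toReal) := by rw [ha, hb]; ring
      rw [this, ← hreal]; field_simp
    have key := ENNReal.lintegral_mul_norm_pow_le (μ := m) (hf.pow_const p.toReal)
      (hf.pow_const q.toReal) ha0 hb0 hab
    have hpt' : ∀ x, (f x ^ p.toReal) ^ a * (f x ^ q.toReal) ^ b = f x ^ s.toReal := by
      intro x
      rw [← ENNReal.rpow_mul, ← ENNReal.rpow_mul,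
        ← ENNReal.rpow_add_of_nonneg _ _ (by positivity) (by positivity)]
      congr 1
      rw [ha, hb]; field_simp; ring
    simp only [hpt'] at key
    rw [eLpNorm_eq_lintegral_rpow_enorm_toReal hs0 hst,
      eLpNorm_eq_lintegral_rpow_enorm_toReal hp0 hpt,
      eLpNorm_eq_lintegral_rpow_enorm_toReal hq0 hqt]
    simp only [enorm_eq_self]
    refine (ENNReal.rpow_le_rpow key (by positivity)).trans_eq ?_
    rw [ENNReal.mul_rpow_of_nonneg _ _ (by positivity), ← ENNReal.rpow_mul, ← ENNReal.rpow_mul,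
      ← ENNReal.rpow_mul, ← ENNReal.rpow_mul]
    congr 2
    · rw [ha]; field_simp
    · rw [hb]; field_simp

namespace PersistenceOT

/-! ### Projection to the diagonal -/

theorem isEmbedding_incl : Topology.IsEmbedding incl :=
  Isometry.isEmbedding fun _ _ => rfl

theorem mem_range_incl {z : closedHalfPlane} : z ∈ range incl ↔ z.1.1 < z.1.2 :=
  ⟨by rintro ⟨w, rfl⟩; exact w.2, fun h => ⟨⟨z.1, h⟩, rfl⟩⟩

theorem measurableEmbedding_incl : MeasurableEmbedding incl := by
  refine isEmbedding_incl.measurableEmbedding ?_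
  have : range incl = {z : closedHalfPlane | z.1.1 < z.1.2} := by
    ext z; exact mem_range_incl
  rw [this]
  exact measurableSet_lt (by fun_prop) (by fun_prop)

/-- The point of the diagonal nearest to `z`: the one with both coordinates the midpoint of those
of `z`. -/
noncomputable def diagProj (z : closedHalfPlane) : closedHalfPlane :=
  ⟨((z.1.1 + z.1.2) / 2, (z.1.1 + z.1.2) / 2), le_refl ((z.1.1 + z.1.2) / 2)⟩

/-- The distance from `z` to the diagonal. -/
noncomputable def diagDist (z : closedHalfPlane) : ℝ≥0∞ := edist z (diagProj z)

theorem continuous_diagProj : Continuous diagProj := by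
  unfold diagProj
  fun_prop

@[fun_prop]
theorem measurable_diagProj : Measurable diagProj := continuous_diagProj.measurable

@[fun_prop]
theorem measurable_diagDist : Measurable diagDist :=
  (continuous_id.edist continuous_diagProj).measurable

theorem diagProj_notMem_range_incl (z : closedHalfPlane) : diagProj z ∉ range incl :=
  fun h => lt_irrefl _ (mem_range_incl.1 h)

theorem diagDist_eq_zero {z : closedHalfPlane} (hz : z ∉ range incl) : diagDist z = 0 := by
  rw [mem_range_incl, not_lt] at hz
  have h : z.1.1 = z.1.2 := le_antisymm z.2 hz
  have : diagProj z = z := by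
    refine Subtype.ext (Prod.ext ?_ ?_) <;> simp only [diagProj] <;> linarith
  rw [diagDist, this, edist_self]

theorem diagDist_le_edist (z : closedHalfPlane) {w : closedHalfPlane} (hw : w ∉ range incl) :
    diagDist z ≤ edist z w := by
  rw [mem_range_incl, not_lt] at hw
  have h : w.1.1 = w.1.2 := le_antisymm w.2 hw
  rw [diagDist, edist_dist, edist_dist]
  refine ENNReal.ofReal_le_ofReal ?_
  rw [Subtype.dist_eq, Subtype.dist_eq, Prod.dist_eq, Prod.dist_eq, Real.dist_eq, Real.dist_eq,
    Real.dist_eq, Real.dist_eq, ← h]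
  have hz : z.1.1 ≤ z.1.2 := z.2
  simp only [diagProj]
  have h1 := le_max_left |z.1.1 - w.1.1| |z.1.2 - w.1.1|
  have h2 := le_max_right |z.1.1 - w.1.1| |z.1.2 - w.1.1|
  have h3 := neg_abs_le (z.1.1 - w.1.1)
  have h4 := le_abs_self (z.1.2 - w.1.1)
  refine max_le (abs_le.2 ⟨?_, ?_⟩) (abs_le.2 ⟨?_, ?_⟩) <;> linarith

/-! ### Transport plans and their costs -/

theorem measurable_edist_prod :
    Measurable fun z : closedHalfPlane × closedHalfPlane => edist z.1 z.2 :=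
  measurable_fst.edist measurable_snd

theorem map_swap_mem_plans {μ ν : Measure openHalfPlane}
    {π : Measure (closedHalfPlane × closedHalfPlane)} (hπ : π ∈ plans μ ν) :
    π.map Prod.swap ∈ plans ν μ := by
  refine ⟨fun A hA => ?_, fun A hA => ?_⟩
  · rw [Measure.map_apply measurable_swap
      ((measurableEmbedding_incl.measurableSet_image.2 hA).prod .univ), preimage_swap_prod]
    exact hπ.2 A hA
  · rw [Measure.map_apply measurable_swap
      (MeasurableSet.univ.prod (measurableEmbedding_incl.measurableSet_image.2 hA)),
      preimage_swap_prod]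
    exact hπ.1 A hA

theorem map_fst_restrict_of_mem_plans {μ ν : Measure openHalfPlane}
    {π : Measure (closedHalfPlane × closedHalfPlane)} (hπ : π ∈ plans μ ν) :
    (π.restrict (Prod.fst ⁻¹' range incl)).map Prod.fst = μ.map incl := by
  ext A hA
  rw [Measure.map_apply measurable_fst hA, Measure.restrict_apply (measurable_fst hA),
    Measure.map_apply measurableEmbedding_incl.measurable hA,
    ← hπ.1 _ (measurableEmbedding_incl.measurable hA), image_preimage_eq_inter_range,
    ← preimage_inter, prod_univ]

theorem eLpNorm_diagDist_fst {μ ν : Measure openHalfPlane}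
    {π : Measure (closedHalfPlane × closedHalfPlane)} (hπ : π ∈ plans μ ν) (q : ℝ≥0∞) :
    eLpNorm (fun z => diagDist z.1) q π = eLpNorm (diagDist ∘ incl) q μ := by
  have hind : (fun z : closedHalfPlane × closedHalfPlane => diagDist z.1)
      = (Prod.fst ⁻¹' range incl).indicator (diagDist ∘ Prod.fst) := by
    ext z
    by_cases hz : z.1 ∈ range incl
    · rw [indicator_of_mem (by exact hz)]; rfl
    · rw [indicator_of_notMem (by exact hz), diagDist_eq_zero hz]
  rw [hind, eLpNorm_indicator_eq_eLpNorm_restrict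
      (measurable_fst measurableEmbedding_incl.measurableSet_range),
    ← eLpNorm_map_measure measurable_diagDist.aestronglyMeasurable measurable_fst.aemeasurable,
    map_fst_restrict_of_mem_plans hπ,
    eLpNorm_map_measure measurable_diagDist.aestronglyMeasurable
      measurableEmbedding_incl.measurable.aemeasurable]

theorem eLpNorm_diagDist_snd {μ ν : Measure openHalfPlane}
    {π : Measure (closedHalfPlane × closedHalfPlane)} (hπ : π ∈ plans μ ν) (q : ℝ≥0∞) :
    eLpNorm (fun z => diagDist z.2) q π = eLpNorm (diagDist ∘ incl) q ν := by
  have hm : Measurable fun z : closedHalfPlane × closedHalfPlane => diagDist z.1 := by fun_prop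
  rw [← eLpNorm_diagDist_fst (map_swap_mem_plans hπ),
    eLpNorm_map_measure hm.aestronglyMeasurable measurable_swap.aemeasurable]
  rfl

theorem wassersteinDist_eq_iInf_eLpNorm {p : ℝ≥0∞} (hp0 : p ≠ 0) (hpt : p ≠ ∞)
    (μ ν : Measure openHalfPlane) :
    wassersteinDist p μ ν = ⨅ π : plans μ ν, eLpNorm (fun z => edist z.1 z.2) p π.1 := by
  have hp : 0 < 1 / p.toReal := one_div_pos.2 (ENNReal.toReal_pos hp0 hpt)
  have h := (ENNReal.orderIsoRpow (1 / p.toReal) hp).map_iInf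
    fun π : plans μ ν => ∫⁻ z, edist z.1 z.2 ^ p.toReal ∂π.1
  simp only [ENNReal.orderIsoRpow_apply] at h
  rw [wassersteinDist, if_neg hpt, ← iInf_subtype'', h]
  simp only [eLpNorm_eq_lintegral_rpow_enorm_toReal hp0 hpt, enorm_eq_self]

/-- For `p = ∞` the essential supremum is at most the supremum over the support, because the
complement of the support is a null set in a second countable space. -/
theorem iInf_eLpNorm_le_wassersteinDist {p : ℝ≥0∞} (hp0 : p ≠ 0) (μ ν : Measure openHalfPlane) :
    ⨅ π : plans μ ν, eLpNorm (fun z => edist z.1 z.2) p π.1 ≤ wassersteinDist p μ ν := by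
  by_cases hpt : p = ∞
  · subst hpt
    rw [wassersteinDist, if_pos rfl, ← iInf_subtype'']
    refine iInf_mono fun π => ?_
    rw [eLpNorm_exponent_top]
    refine eLpNormEssSup_le_of_ae_enorm_bound ?_
    filter_upwards [Measure.support_mem_ae (μ := π.1)] with z hz
    exact le_iSup₂ (f := fun (z : closedHalfPlane × closedHalfPlane) (_ : z ∈ π.1.support) =>
      edist z.1 z.2) z hz
  · exact (wassersteinDist_eq_iInf_eLpNorm hp0 hpt μ ν).ge

/-- A plan to the empty diagram moves every point at least as far as the diagonal. -/
theorem eLpNorm_diagDist_incl_le_pers {q : ℝ≥0∞} (hq0 : q ≠ 0) (μ : Measure openHalfPlane) :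
    eLpNorm (diagDist ∘ incl) q μ ≤ pers q μ := by
  refine le_trans (le_iInf fun π => ?_) (iInf_eLpNorm_le_wassersteinDist hq0 μ 0)
  rw [← eLpNorm_diagDist_fst π.2]
  refine eLpNorm_mono_enorm_ae ?_
  have hnull : π.1 (univ ×ˢ range incl) = 0 := by
    simpa using π.2.2 univ .univ
  filter_upwards [measure_eq_zero_iff_ae_notMem.1 hnull] with z hz
  exact diagDist_le_edist z.1 fun h => hz ⟨mem_univ _, h⟩

/-- Every pair of persistence measures admits a plan: the one that sends all of `μ` to the diagonal
and takes all of `ν` from it. -/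
theorem plans_nonempty (μ ν : Measure openHalfPlane) : (plans μ ν).Nonempty := by
  have hi := measurableEmbedding_incl.measurable
  refine ⟨μ.map (fun z => (incl z, diagProj (incl z))) +
    ν.map (fun z => (diagProj (incl z), incl z)), fun A hA => ?_, fun A hA => ?_⟩
  · have hA' := (measurableEmbedding_incl.measurableSet_image.2 hA).prod
      (.univ : MeasurableSet (univ : Set closedHalfPlane))
    rw [Measure.add_apply, Measure.map_apply (by fun_prop) hA', Measure.map_apply (by fun_prop) hA']
    simp only [prod_univ, ← preimage_comp, Function.comp_def]
    rw [show incl ⁻¹' (incl '' A) = A from preimage_image_eq _ measurableEmbedding_incl.injective,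
      show (fun z => diagProj (incl z)) ⁻¹' (incl '' A) = ∅ from eq_empty_of_forall_notMem
        fun z hz => diagProj_notMem_range_incl _ (image_subset_range _ _ hz)]
    simp
  · have hA' := (.univ : MeasurableSet (univ : Set closedHalfPlane)).prod
      (measurableEmbedding_incl.measurableSet_image.2 hA)
    rw [Measure.add_apply, Measure.map_apply (by fun_prop) hA', Measure.map_apply (by fun_prop) hA']
    simp only [univ_prod, ← preimage_comp, Function.comp_def]
    rw [show incl ⁻¹' (incl '' A) = A from preimage_image_eq _ measurableEmbedding_incl.injective,
      show (fun z => diagProj (incl z)) ⁻¹' (incl '' A) = ∅ from eq_empty_of_forall_notMem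
        fun z hz => diagProj_notMem_range_incl _ (image_subset_range _ _ hz)]
    simp

/-! ### Rerouting a plan through the diagonal -/

/-- The pairs of points whose direct distance is at most the detour through the diagonal. -/
def directPairs : Set (closedHalfPlane × closedHalfPlane) :=
  {z | edist z.1 z.2 ≤ diagDist z.1 + diagDist z.2}

theorem measurableSet_directPairs : MeasurableSet directPairs :=
  measurableSet_le measurable_edist_prod (by fun_prop)

/-- The plan `π` with every pair outside `directPairs` replaced by two pairs, which match each of
its points with the projection of that point to the diagonal. -/
noncomputable def rerouted (π : Measure (closedHalfPlane × closedHalfPlane)) :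
    Measure (closedHalfPlane × closedHalfPlane) :=
  π.restrict directPairs + ((π.restrict directPairsᶜ).map (fun z => (z.1, diagProj z.1)) +
    (π.restrict directPairsᶜ).map (fun z => (diagProj z.2, z.2)))

theorem rerouted_mem_plans {μ ν : Measure openHalfPlane}
    {π : Measure (closedHalfPlane × closedHalfPlane)} (hπ : π ∈ plans μ ν) :
    rerouted π ∈ plans μ ν := by
  refine ⟨fun A hA => ?_, fun A hA => ?_⟩
  · have hA' := (measurableEmbedding_incl.measurableSet_image.2 hA).prod
      (.univ : MeasurableSet (univ : Set closedHalfPlane))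
    rw [rerouted, Measure.add_apply, Measure.add_apply, Measure.map_apply (by fun_prop) hA',
      Measure.map_apply (by fun_prop) hA']
    rw [show (fun z : closedHalfPlane × closedHalfPlane => (z.1, diagProj z.1)) ⁻¹'
          ((incl '' A) ×ˢ univ) = (incl '' A) ×ˢ univ by ext z; simp,
      show (fun z : closedHalfPlane × closedHalfPlane => (diagProj z.2, z.2)) ⁻¹'
          ((incl '' A) ×ˢ univ) = ∅ from eq_empty_of_forall_notMem
        fun z hz => diagProj_notMem_range_incl _ (image_subset_range _ _ hz.1),
      measure_empty, add_zero, ← Measure.add_apply,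
      Measure.restrict_add_restrict_compl measurableSet_directPairs]
    exact hπ.1 A hA
  · have hA' := (.univ : MeasurableSet (univ : Set closedHalfPlane)).prod
      (measurableEmbedding_incl.measurableSet_image.2 hA)
    rw [rerouted, Measure.add_apply, Measure.add_apply, Measure.map_apply (by fun_prop) hA',
      Measure.map_apply (by fun_prop) hA']
    rw [show (fun z : closedHalfPlane × closedHalfPlane => (diagProj z.2, z.2)) ⁻¹'
          (univ ×ˢ (incl '' A)) = univ ×ˢ (incl '' A) by ext z; simp,
      show (fun z : closedHalfPlane × closedHalfPlane => (z.1, diagProj z.1)) ⁻¹'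
          (univ ×ˢ (incl '' A)) = ∅ from eq_empty_of_forall_notMem
        fun z hz => diagProj_notMem_range_incl _ (image_subset_range _ _ hz.2),
      measure_empty, zero_add, ← Measure.add_apply,
      Measure.restrict_add_restrict_compl measurableSet_directPairs]
    exact hπ.2 A hA

theorem rerouted_ae_mem_directPairs (π : Measure (closedHalfPlane × closedHalfPlane)) :
    ∀ᵐ z ∂rerouted π, z ∈ directPairs := by
  rw [rerouted, ae_add_measure_iff, ae_add_measure_iff]
  refine ⟨ae_restrict_mem measurableSet_directPairs, ?_, ?_⟩
  · refine (ae_map_iff (by fun_prop) measurableSet_directPairs).2 ?_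
    exact Filter.Eventually.of_forall fun z => le_self_add
  · refine (ae_map_iff (by fun_prop) measurableSet_directPairs).2 ?_
    refine Filter.Eventually.of_forall fun z => ?_
    change edist (diagProj z.2) z.2 ≤ _
    rw [edist_comm]
    exact le_add_self

theorem eLpNorm_rerouted_le {p : ℝ≥0∞} (hp1 : 1 ≤ p) (hpt : p ≠ ∞)
    (π : Measure (closedHalfPlane × closedHalfPlane)) :
    eLpNorm (fun z => edist z.1 z.2) p (rerouted π) ≤ eLpNorm (fun z => edist z.1 z.2) p π := by
  have hp0 : p ≠ 0 := (one_pos.trans_le hp1).ne'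
  have hp : 1 ≤ p.toReal := by simpa using ENNReal.toReal_mono hpt hp1
  have hm := measurable_edist_prod.pow_const p.toReal
  rw [eLpNorm_eq_lintegral_rpow_enorm_toReal hp0 hpt,
    eLpNorm_eq_lintegral_rpow_enorm_toReal hp0 hpt]
  simp only [enorm_eq_self]
  refine ENNReal.rpow_le_rpow ?_ (by positivity)
  rw [rerouted, lintegral_add_measure, lintegral_add_measure, lintegral_map hm (by fun_prop),
    lintegral_map hm (by fun_prop),
    ← lintegral_add_compl (μ := π) (fun z => edist z.1 z.2 ^ p.toReal) measurableSet_directPairs]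
  refine add_le_add (le_refl (∫⁻ z in directPairs, edist z.1 z.2 ^ p.toReal ∂π)) ?_
  have hm' : Measurable fun z : closedHalfPlane × closedHalfPlane => diagDist z.1 ^ p.toReal := by
    fun_prop
  refine (lintegral_add_left hm' _).ge.trans ?_
  refine setLIntegral_mono hm fun z hz => ?_
  have hz' : diagDist z.1 + diagDist z.2 ≤ edist z.1 z.2 :=
    (lt_of_not_ge (show ¬ edist z.1 z.2 ≤ diagDist z.1 + diagDist z.2 from hz)).le
  simp only [edist_comm (diagProj z.2) z.2]
  exact (ENNReal.add_rpow_le_rpow_add _ _ hp).trans (ENNReal.rpow_le_rpow hz' (by positivity))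

theorem eLpNorm_edist_rerouted_le_pers {q : ℝ≥0∞} (hq1 : 1 ≤ q) {μ ν : Measure openHalfPlane}
    {π : Measure (closedHalfPlane × closedHalfPlane)} (hπ : π ∈ plans μ ν) :
    eLpNorm (fun z => edist z.1 z.2) q (rerouted π) ≤ pers q μ + pers q ν := by
  have hq0 : q ≠ 0 := (one_pos.trans_le hq1).ne'
  have hπ' := rerouted_mem_plans hπ
  have hm1 : Measurable fun z : closedHalfPlane × closedHalfPlane => diagDist z.1 := by fun_prop
  have hm2 : Measurable fun z : closedHalfPlane × closedHalfPlane => diagDist z.2 := by fun_prop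
  have h1 := (eLpNorm_diagDist_fst hπ' q).trans_le (eLpNorm_diagDist_incl_le_pers hq0 μ)
  have h2 := (eLpNorm_diagDist_snd hπ' q).trans_le (eLpNorm_diagDist_incl_le_pers hq0 ν)
  have hmono : eLpNorm (fun z => edist z.1 z.2) q (rerouted π) ≤
      eLpNorm ((fun z => diagDist z.1) + fun z => diagDist z.2) q (rerouted π) := by
    refine eLpNorm_mono_enorm_ae ?_
    filter_upwards [rerouted_ae_mem_directPairs π] with z hz
    rw [enorm_eq_self, enorm_eq_self, Pi.add_apply]
    exact hz
  have hadd := eLpNorm_add_le (μ := rerouted π) hm1.aestronglyMeasurable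
    hm2.aestronglyMeasurable hq1
  exact hmono.trans (hadd.trans (add_le_add h1 h2))

/-! ### Interpolation of the distances -/

/-- Interpolation of the distances without a constant. Only the total `q`-persistence has to be
finite, so that multiplication by it commutes with the infimum over the plans. -/
theorem wassersteinDist_le_rpow_mul_rpow {p q s : ℝ≥0∞} {θ : ℝ} (hp1 : 1 ≤ p) (hpt : p ≠ ∞)
    (hq1 : 1 ≤ q) (hθ0 : 0 < θ) (hθ1 : θ < 1)
    (hs : 1 / s = ENNReal.ofReal θ / p + ENNReal.ofReal (1 - θ) / q)
    {μ ν : Measure openHalfPlane} (hμ : pers q μ ≠ ∞) (hν : pers q ν ≠ ∞) :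
    wassersteinDist s μ ν ≤ wassersteinDist p μ ν ^ θ * (pers q μ + pers q ν) ^ (1 - θ) := by
  have hp0 : p ≠ 0 := (one_pos.trans_le hp1).ne'
  have hq0 : q ≠ 0 := (one_pos.trans_le hq1).ne'
  have hs0 : s ≠ 0 := by
    rintro rfl
    rw [ENNReal.div_zero one_ne_zero, eq_comm, ENNReal.add_eq_top] at hs
    rcases hs with h | h
    · exact ENNReal.div_ne_top ENNReal.ofReal_ne_top hp0 h
    · exact ENNReal.div_ne_top ENNReal.ofReal_ne_top hq0 h
  have hst : s ≠ ∞ := by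
    rintro rfl
    rw [ENNReal.div_top, eq_comm, add_eq_zero] at hs
    have := (ENNReal.div_eq_zero_iff.1 hs.1).resolve_right hpt
    exact (ENNReal.ofReal_pos.2 hθ0).ne' this
  have : Nonempty (plans μ ν) := (plans_nonempty μ ν).to_subtype
  have hM : (pers q μ + pers q ν) ^ (1 - θ) ≠ ∞ :=
    ENNReal.rpow_ne_top_of_nonneg (by linarith) (ENNReal.add_ne_top.2 ⟨hμ, hν⟩)
  have h := (ENNReal.orderIsoRpow θ hθ0).map_iInf
    fun π : plans μ ν => eLpNorm (fun z => edist z.1 z.2) p π.1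
  simp only [ENNReal.orderIsoRpow_apply] at h
  rw [wassersteinDist_eq_iInf_eLpNorm hp0 hpt, wassersteinDist_eq_iInf_eLpNorm hs0 hst, h,
    ENNReal.iInf_mul fun hM' => absurd hM' hM]
  refine le_iInf fun π => (iInf_le _ ⟨rerouted π.1, rerouted_mem_plans π.2⟩).trans ?_
  refine (eLpNorm_le_rpow_mul_rpow measurable_edist_prod.aemeasurable hθ0 hθ1 hp0 hpt hq0 hs0 hst
    hs).trans ?_
  exact mul_le_mul' (ENNReal.rpow_le_rpow (eLpNorm_rerouted_le hp1 hpt π.1) hθ0.le)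
    (ENNReal.rpow_le_rpow (eLpNorm_edist_rerouted_le_pers hq1 π.2) (by linarith))

theorem pers_zero {p : ℝ≥0∞} (hp0 : p ≠ 0) : pers p 0 = 0 := by
  have h0 : (0 : Measure (closedHalfPlane × closedHalfPlane)) ∈ plans 0 0 := by
    simp [plans]
  by_cases hpt : p = ∞
  · subst hpt
    rw [pers, wassersteinDist, if_pos rfl]
    exact le_antisymm ((iInf₂_le 0 h0).trans (by simp)) zero_le
  · rw [pers, wassersteinDist_eq_iInf_eLpNorm hp0 hpt]
    exact le_antisymm ((iInf_le _ ⟨0, h0⟩).trans (by simp)) zero_le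

/-- An exponent strictly between `p` and `q` has its reciprocal strictly between theirs. -/
theorem exists_interpolation_parameter {p q r : ℝ≥0∞} (hp0 : p ≠ 0) (hpr : p < r) (hrq : r < q) :
    ∃ θ : ℝ, 0 < θ ∧ θ < 1 ∧ 1 / r = ENNReal.ofReal θ / p + ENNReal.ofReal (1 - θ) / q := by
  have hr0 : r ≠ 0 := (pos_iff_ne_zero.2 hp0 |>.trans hpr).ne'
  have hq0 : q ≠ 0 := (pos_iff_ne_zero.2 hr0 |>.trans hrq).ne'
  have hfin {x : ℝ≥0∞} (hx : x ≠ 0) : x⁻¹ ≠ ∞ := ENNReal.inv_ne_top.2 hx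
  set a := p⁻¹.toReal
  set b := q⁻¹.toReal
  set c := r⁻¹.toReal
  have hca : c < a := ENNReal.toReal_strict_mono (hfin hp0) (ENNReal.inv_lt_inv.2 hpr)
  have hbc : b < c := ENNReal.toReal_strict_mono (hfin hr0) (ENNReal.inv_lt_inv.2 hrq)
  have hab : 0 < a - b := by linarith
  have hθ1 : (c - b) / (a - b) < 1 := (div_lt_one hab).2 (by linarith)
  have hθ0 : 0 < (c - b) / (a - b) := div_pos (by linarith) hab
  refine ⟨(c - b) / (a - b), hθ0, hθ1, ?_⟩
  have h1 : 0 ≤ 1 - (c - b) / (a - b) := by linarith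
  rw [one_div, div_eq_mul_inv _ p, div_eq_mul_inv _ q, ← ENNReal.ofReal_toReal (hfin hp0),
    ← ENNReal.ofReal_toReal (hfin hq0), ← ENNReal.ofReal_toReal (hfin hr0),
    ← ENNReal.ofReal_mul hθ0.le, ← ENNReal.ofReal_mul h1,
    ← ENNReal.ofReal_add (mul_nonneg hθ0.le ENNReal.toReal_nonneg)
      (mul_nonneg h1 ENNReal.toReal_nonneg)]
  congr 1
  change c = (c - b) / (a - b) * a + (1 - (c - b) / (a - b)) * b
  field_simp
  ring

end PersistenceOT

theorem mainTheorem10 (p q : ℝ≥0∞) (hp : 1 ≤ p) (hpq : p < q) :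
    (∀ θ : ℝ, 0 < θ → θ < 1 →
      ∀ pθ : ℝ≥0∞, 1 / pθ = ENNReal.ofReal θ / p + ENNReal.ofReal (1 - θ) / q →
      ∀ μ ∈ PersistenceOT.finitePers p ∩ PersistenceOT.finitePers q,
      ∀ ν ∈ PersistenceOT.finitePers p ∩ PersistenceOT.finitePers q,
        PersistenceOT.wassersteinDist pθ μ ν ≤
          2 ^ (1 - θ) * PersistenceOT.wassersteinDist p μ ν ^ θ *
            (PersistenceOT.pers q μ + PersistenceOT.pers q ν) ^ (1 - θ)) ∧
    (∀ r : ℝ≥0∞, p ≤ r → r ≤ q →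
      PersistenceOT.finitePers p ∩ PersistenceOT.finitePers q ⊆ PersistenceOT.finitePers r) := by
  have hp0 : p ≠ 0 := (one_pos.trans_le hp).ne'
  have hpt : p ≠ ∞ := hpq.ne_top
  have hq1 : 1 ≤ q := hp.trans hpq.le
  refine ⟨fun θ hθ0 hθ1 s hs μ hμ ν hν => ?_, fun r hpr hrq μ hμ => ?_⟩
  · refine (PersistenceOT.wassersteinDist_le_rpow_mul_rpow hp hpt hq1 hθ0 hθ1 hs
      (ne_of_lt hμ.2) (ne_of_lt hν.2)).trans ?_
    rw [mul_assoc]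
    exact le_mul_of_one_le_left zero_le
      (ENNReal.one_le_rpow one_le_two (by linarith))
  · rcases hpr.eq_or_lt with rfl | hpr
    · exact hμ.1
    rcases hrq.eq_or_lt with rfl | hrq
    · exact hμ.2
    obtain ⟨θ, hθ0, hθ1, hs⟩ := PersistenceOT.exists_interpolation_parameter hp0 hpr hrq
    have hz : PersistenceOT.pers q 0 = 0 := PersistenceOT.pers_zero (one_pos.trans_le hq1).ne'
    refine (PersistenceOT.wassersteinDist_le_rpow_mul_rpow (ν := 0) hp hpt hq1 hθ0 hθ1 hs
      (ne_of_lt hμ.2) (hz ▸ ENNReal.zero_ne_top)).trans_lt ?_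
    rw [hz, add_zero]
    exact ENNReal.mul_lt_top (ENNReal.rpow_lt_top_of_nonneg hθ0.le (ne_of_lt hμ.1))
      (ENNReal.rpow_lt_top_of_nonneg (by linarith) (ne_of_lt hμ.2))
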